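/- Let $n\ge 2$. Let $\mathcal T_n=\{A\in M_n(\mathbb C): A_{ij}=0 \text{ whenever } |i-j|\ge 2\}$ be the operator system of tridiagonal matrices. Let $C^*(\mathbb F_{n-1})$ be the full group C$^*$-algebra of the free group on $n-1$ generators, let $u_1,\dots,u_{n-1}\in C^*(\mathbb F_{n-1})$ be the universal unitaries corresponding to the free generators, and let $$\mathcal S_{n-1}=\operatorname{Span}\{1,u_j,u_j^*: 1\le j\le n-1\}\subseteq C^*(\mathbb F_{n-1}).$$ Let $\mathcal V_n,\mathcal U_n\subseteq\bigoplus_{k=1}^{n-1}M_2(\mathbb C)$ be the operator subsystems $$\mathcal V_n=\Big\{\bigoplus_{k=1}^{n-1}\begin{bmatrix}a^k_{11}&a^k_{12}\\a^k_{21}&a^k_{22}\end{bmatrix}: a^k_{22}=a^{k+1}_{11}\ \text{ for all } 1\le k\le n-2\Big\},$$ $$\mathcal U_n=\Big\{\bigoplus_{k=1}^{n-1}\begin{bmatrix}a^k_{11}&a^k_{12}\\a^k_{21}&a^k_{22}\end{bmatrix}: a^k_{ii}=a^\ell_{jj}\ \text{ for all } 1\le k,\ell\le n-1,\ i,j\in\{1,2\}\Big\}.$$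 For a finite-dimensional operator system $\mathcal S$, the dual $\mathcal S^d$ is the space of linear functionals on $\mathcal S$ with the involution $f^*(s)=\overline{f(s^*)}$ and the matrix ordering in which $G=[g_{ij}]\in M_p(\mathcal S^d)$ is positive if and only if the map $\hat G:\mathcal S\to M_p(\mathbb C)$, $\hat G(s)=[g_{ij}(s)]$, is completely positive. Two matricially ordered spaces are completely order isomorphic if there is a linear isomorphism $\phi$ between them such that $\phi$ and $\phi^{-1}$ are completely positive. Then: 1. $\mathcal T_n^d$ and $\mathcal V_n$ are completely order isomorphic; 2. $\mathcal S_{n-1}^d$ and $\mathcal U_n$ are completely order isomorphic. -/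

import Mathlib

open scoped Matrix ComplexOrder ENNReal

noncomputable section

namespace OpSys

/-! ### Matricially ordered spaces and operator systems -/

/-- The compression `αᴴ X α` of a matrix `X` over a complex vector space by a scalar matrix `α`. -/
def compress {V : Type*} [AddCommGroup V] [Module ℂ V] {p q : ℕ}
    (α : Matrix (Fin p) (Fin q) ℂ) (X : Matrix (Fin p) (Fin p) V) : Matrix (Fin q) (Fin q) V :=
  fun k l => ∑ i, ∑ j, (star (α i k) * α j l) • X i j

/-- The diagonal matrix over `V` with the vector `e` in every diagonal position. -/
def diagUnit {V : Type*} [AddCommGroup V] (p : ℕ) (e : V) : Matrix (Fin p) (Fin p) V :=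
  Matrix.diagonal fun _ => e

/-- A matricially ordered complex `*`-vector space: proper cones `pos p ⊆ M_p(V)_sa`, compatible
with compressions by scalar matrices (taking `α = √r` shows that each `pos p` is closed under
multiplication by nonnegative reals). -/
class MatrixOrderedSpace (V : Type*) [AddCommGroup V] [Module ℂ V] [StarAddMonoid V]
    [StarModule ℂ V] where
  pos : ∀ p : ℕ, Set (Matrix (Fin p) (Fin p) V)
  selfAdjoint_of_pos : ∀ {p : ℕ} {X : Matrix (Fin p) (Fin p) V}, X ∈ pos p → Xᴴ = X
  zero_pos : ∀ p : ℕ, (0 : Matrix (Fin p) (Fin p) V) ∈ pos p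
  add_pos : ∀ {p : ℕ} {X Y : Matrix (Fin p) (Fin p) V}, X ∈ pos p → Y ∈ pos p → X + Y ∈ pos p
  proper : ∀ {p : ℕ} {X : Matrix (Fin p) (Fin p) V}, X ∈ pos p → -X ∈ pos p → X = 0
  compress_pos : ∀ {p q : ℕ} (α : Matrix (Fin p) (Fin q) ℂ) {X : Matrix (Fin p) (Fin p) V},
    X ∈ pos p → compress α X ∈ pos q

/-- An (abstract) operator system: a matricially ordered `*`-vector space with an Archimedean
matrix order unit. -/
class OperatorSystem (V : Type*) [AddCommGroup V] [Module ℂ V] [StarAddMonoid V]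
    [StarModule ℂ V] extends MatrixOrderedSpace V where
  unit : V
  star_unit : star unit = unit
  order_unit : ∀ {p : ℕ} (X : Matrix (Fin p) (Fin p) V), Xᴴ = X →
    ∃ r : ℝ, 0 < r ∧ (r : ℂ) • diagUnit p unit + X ∈ pos p
  archimedean : ∀ {p : ℕ} (X : Matrix (Fin p) (Fin p) V),
    (∀ ε : ℝ, 0 < ε → (ε : ℂ) • diagUnit p unit + X ∈ pos p) → X ∈ pos p

/-- A linear map is completely positive if all its amplifications preserve the positive cones. -/
def IsCompletelyPositive {V W : Type*} [AddCommGroup V] [Module ℂ V] [StarAddMonoid V]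
    [StarModule ℂ V] [MatrixOrderedSpace V] [AddCommGroup W] [Module ℂ W] [StarAddMonoid W]
    [StarModule ℂ W] [MatrixOrderedSpace W] (φ : V →ₗ[ℂ] W) : Prop :=
  ∀ (p : ℕ) (X : Matrix (Fin p) (Fin p) V),
    X ∈ MatrixOrderedSpace.pos p → X.map φ ∈ MatrixOrderedSpace.pos p

/-- `V` and `W` are completely order isomorphic: there is a linear isomorphism `φ : V → W` such
that `φ` and `φ⁻¹` are completely positive. -/
def CompletelyOrderIsomorphic (V W : Type*) [AddCommGroup V] [Module ℂ V] [StarAddMonoid V]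
    [StarModule ℂ V] [MatrixOrderedSpace V] [AddCommGroup W] [Module ℂ W] [StarAddMonoid W]
    [StarModule ℂ W] [MatrixOrderedSpace W] : Prop :=
  ∃ φ : V ≃ₗ[ℂ] W,
    IsCompletelyPositive (φ : V →ₗ[ℂ] W) ∧ IsCompletelyPositive (φ.symm : W →ₗ[ℂ] V)

/-! ### Operator subsystems of unital C⋆-algebras -/

/-- An operator subsystem of a unital C⋆-algebra: a unital self-adjoint linear subspace. -/
structure OperatorSubsystem (A : Type*) [CStarAlgebra A] extends Submodule ℂ A where
  one_mem' : (1 : A) ∈ carrier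
  star_mem' : ∀ {a : A}, a ∈ carrier → star a ∈ carrier

/-- The positive cone of `M_p(A)` for a C⋆-algebra `A`: the matrices `Bᴴ B` with `B ∈ M_p(A)`. -/
def matrixPos (A : Type*) [CStarAlgebra A] (p : ℕ) : Set (Matrix (Fin p) (Fin p) A) :=
  {X | ∃ B : Matrix (Fin p) (Fin p) A, X = Bᴴ * B}

section MatrixPosFacts

theorem nonneg_iff_star_mul {B : Type*} [CStarAlgebra B] [PartialOrder B] [StarOrderedRing B]
    (x : B) : 0 ≤ x ↔ ∃ b, x = star b * b :=
  CStarAlgebra.nonneg_iff_eq_star_mul_self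

theorem exists_pos_shift_nonneg {B : Type*} [CStarAlgebra B] [PartialOrder B]
    [StarOrderedRing B] {x : B} (hx : IsSelfAdjoint x) :
    ∃ r : ℝ, 0 < r ∧ 0 ≤ (r : ℂ) • (1 : B) + x := by
  refine ⟨‖x‖ + 1, by positivity, ?_⟩
  have h1 := hx.neg_algebraMap_norm_le_self
  rw [Algebra.algebraMap_eq_smul_one, neg_le_iff_add_nonneg] at h1
  have h2 := add_nonneg h1 (zero_le_one (α := B))
  rw [Complex.coe_smul, add_smul, one_smul]
  convert h2 using 1
  abel

variable {A : Type*} [CStarAlgebra A]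

theorem mem_matrixPos_iff_nonneg {p : ℕ} (X : Matrix (Fin p) (Fin p) A) :
    letI : PartialOrder A := CStarAlgebra.spectralOrder A
    haveI : StarOrderedRing A := CStarAlgebra.spectralOrderedRing A
    X ∈ matrixPos A p ↔ 0 ≤ CStarMatrix.ofMatrix X := by
  let _ : PartialOrder A := CStarAlgebra.spectralOrder A
  have _ : StarOrderedRing A := CStarAlgebra.spectralOrderedRing A
  exact (nonneg_iff_star_mul (CStarMatrix.ofMatrix X)).symm

theorem matrixPos_selfAdjoint {p : ℕ} {X : Matrix (Fin p) (Fin p) A} (h : X ∈ matrixPos A p) :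
    Xᴴ = X := by
  obtain ⟨B, rfl⟩ := h
  simp

theorem matrixPos_zero (p : ℕ) : (0 : Matrix (Fin p) (Fin p) A) ∈ matrixPos A p :=
  ⟨0, by simp⟩

theorem matrixPos_add {p : ℕ} {X Y : Matrix (Fin p) (Fin p) A} (hX : X ∈ matrixPos A p)
    (hY : Y ∈ matrixPos A p) : X + Y ∈ matrixPos A p := by
  let _ : PartialOrder A := CStarAlgebra.spectralOrder A
  have _ : StarOrderedRing A := CStarAlgebra.spectralOrderedRing A
  have hX' := (mem_matrixPos_iff_nonneg X).1 hX
  have hY' := (mem_matrixPos_iff_nonneg Y).1 hY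
  exact (mem_matrixPos_iff_nonneg (X + Y)).2 (add_nonneg hX' hY')

theorem matrixPos_proper {p : ℕ} {X : Matrix (Fin p) (Fin p) A} (hX : X ∈ matrixPos A p)
    (hY : -X ∈ matrixPos A p) : X = 0 := by
  let _ : PartialOrder A := CStarAlgebra.spectralOrder A
  have _ : StarOrderedRing A := CStarAlgebra.spectralOrderedRing A
  have hX' : 0 ≤ CStarMatrix.ofMatrix X := (mem_matrixPos_iff_nonneg X).1 hX
  have hY' : 0 ≤ -CStarMatrix.ofMatrix X := (mem_matrixPos_iff_nonneg (-X)).1 hY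
  have h : CStarMatrix.ofMatrix X = 0 := le_antisymm (neg_nonneg.1 hY') hX'
  exact h

theorem matrixPos_conj {p q : ℕ} (C : Matrix (Fin p) (Fin q) A) :
    Cᴴ * C ∈ matrixPos A q := by
  classical
  rcases q with _ | q
  · exact ⟨0, by ext i; exact i.elim0⟩
  · have key : Cᴴ * C = ∑ k : Fin p,
        (Matrix.of fun (i : Fin (q + 1)) j => if i = 0 then C k j else 0)ᴴ *
        (Matrix.of fun (i : Fin (q + 1)) j => if i = 0 then C k j else 0) := by
      ext i j
      rw [Matrix.sum_apply]
      simp only [Matrix.mul_apply, Matrix.conjTranspose_apply, Matrix.of_apply]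
      refine Finset.sum_congr rfl fun k _ => ?_
      rw [Finset.sum_eq_single 0] <;> simp +contextual
    rw [key]
    refine Finset.sum_induction _ (· ∈ matrixPos A (q + 1)) (fun _ _ => matrixPos_add)
      (matrixPos_zero _) fun k _ => ⟨_, rfl⟩

theorem compress_eq_mul {p q : ℕ} (α : Matrix (Fin p) (Fin q) ℂ) (X : Matrix (Fin p) (Fin p) A) :
    compress α X = (α.map (algebraMap ℂ A))ᴴ * X * α.map (algebraMap ℂ A) := by
  ext k l
  simp only [compress, Matrix.mul_apply, Matrix.conjTranspose_apply, Matrix.map_apply,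
    Finset.sum_mul]
  rw [Finset.sum_comm]
  refine Finset.sum_congr rfl fun j _ => Finset.sum_congr rfl fun i _ => ?_
  rw [← algebraMap_star_comm, ← Algebra.commutes (α j l), ← mul_assoc, ← map_mul,
    mul_comm (α j l), Algebra.smul_def]

theorem matrixPos_compress {p q : ℕ} (α : Matrix (Fin p) (Fin q) ℂ)
    {X : Matrix (Fin p) (Fin p) A} (hX : X ∈ matrixPos A p) : compress α X ∈ matrixPos A q := by
  obtain ⟨B, rfl⟩ := hX
  have := matrixPos_conj (B * α.map (algebraMap ℂ A))
  rwa [Matrix.conjTranspose_mul, Matrix.mul_assoc, ← Matrix.mul_assoc Bᴴ,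
    ← Matrix.mul_assoc, ← compress_eq_mul] at this

theorem matrixPos_order_unit {p : ℕ} (X : Matrix (Fin p) (Fin p) A) (hX : Xᴴ = X) :
    ∃ r : ℝ, 0 < r ∧ (r : ℂ) • diagUnit p (1 : A) + X ∈ matrixPos A p := by
  let _ : PartialOrder A := CStarAlgebra.spectralOrder A
  have _ : StarOrderedRing A := CStarAlgebra.spectralOrderedRing A
  have hsa : IsSelfAdjoint (CStarMatrix.ofMatrix X) := hX
  obtain ⟨r, hr, h⟩ := exists_pos_shift_nonneg hsa
  exact ⟨r, hr, (mem_matrixPos_iff_nonneg _).2 h⟩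

theorem matrixPos_archimedean {p : ℕ} (X : Matrix (Fin p) (Fin p) A)
    (h : ∀ ε : ℝ, 0 < ε → (ε : ℂ) • diagUnit p (1 : A) + X ∈ matrixPos A p) :
    X ∈ matrixPos A p := by
  let _ : PartialOrder A := CStarAlgebra.spectralOrder A
  have _ : StarOrderedRing A := CStarAlgebra.spectralOrderedRing A
  refine (mem_matrixPos_iff_nonneg _).2 ?_
  have hlim : Filter.Tendsto
      (fun ε : ℝ => ε • (1 : CStarMatrix (Fin p) (Fin p) A) + CStarMatrix.ofMatrix X)
      (nhdsWithin 0 (Set.Ioi 0)) (nhds (CStarMatrix.ofMatrix X)) := by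
    have hc : Continuous
        (fun ε : ℝ => ε • (1 : CStarMatrix (Fin p) (Fin p) A) + CStarMatrix.ofMatrix X) := by
      fun_prop
    have := (hc.tendsto 0).mono_left (nhdsWithin_le_nhds (s := Set.Ioi 0))
    simpa using this
  refine CStarAlgebra.isClosed_nonneg.mem_of_tendsto hlim ?_
  filter_upwards [self_mem_nhdsWithin] with ε hε
  have := (mem_matrixPos_iff_nonneg _).1 (h ε hε)
  change 0 ≤ (ε : ℂ) • (1 : CStarMatrix (Fin p) (Fin p) A) + CStarMatrix.ofMatrix X at this
  rwa [Complex.coe_smul] at this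

end MatrixPosFacts

namespace OperatorSubsystem

variable {A : Type*} [CStarAlgebra A]

instance : CoeSort (OperatorSubsystem A) (Type _) := ⟨fun S => S.toSubmodule⟩

variable (S : OperatorSubsystem A)

instance : Star S := ⟨fun x => ⟨star (x : A), S.star_mem' x.2⟩⟩

@[simp] theorem coe_star (x : S) : ((star x : S) : A) = star (x : A) := rfl

instance : StarAddMonoid S where
  star_involutive x := Subtype.ext (star_star (x : A))
  star_add x y := Subtype.ext (star_add (x : A) y)

instance : StarModule ℂ S where
  star_smul c x := Subtype.ext (star_smul c (x : A))

/-- The entrywise inclusion `M_p(S) ⊆ M_p(A)`. -/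
def incl {p : ℕ} (X : Matrix (Fin p) (Fin p) S) : Matrix (Fin p) (Fin p) A :=
  X.map fun x => (x : A)

theorem incl_injective {p : ℕ} : Function.Injective (incl S (p := p)) := fun X Y h => by
  ext i j
  exact congrFun (congrFun h i) j

theorem incl_compress {p q : ℕ} (α : Matrix (Fin p) (Fin q) ℂ) (X : Matrix (Fin p) (Fin p) S) :
    incl S (compress α X) = compress α (incl S X) := by
  ext k l
  simp [incl, compress]

theorem incl_unit {p : ℕ} (r : ℝ) (X : Matrix (Fin p) (Fin p) S) :
    incl S ((r : ℂ) • diagUnit p (⟨1, S.one_mem'⟩ : S) + X) =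
      (r : ℂ) • diagUnit p (1 : A) + incl S X := by
  ext i j
  by_cases h : i = j
  · subst h
    simp [incl, diagUnit]
  · simp [incl, diagUnit, h]

/-- The operator system structure inherited from the ambient C⋆-algebra:
`M_p(S)_+ = M_p(S) ∩ M_p(A)_+`, with order unit `1`. -/
instance instOperatorSystem : OperatorSystem S where
  pos p := {X | incl S X ∈ matrixPos A p}
  selfAdjoint_of_pos {p X} hX := incl_injective S (matrixPos_selfAdjoint (X := incl S X) hX)
  zero_pos p := matrixPos_zero p
  add_pos hX hY := matrixPos_add hX hY
  proper {p X} hX hY := incl_injective S (matrixPos_proper (X := incl S X) hX hY)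
  compress_pos {p q} α {X} hX := by
    change incl S (compress α X) ∈ matrixPos A q
    rw [incl_compress]
    exact matrixPos_compress α hX
  unit := ⟨1, S.one_mem'⟩
  star_unit := Subtype.ext (star_one A)
  order_unit {p} X hX := by
    obtain ⟨r, hr, h⟩ := matrixPos_order_unit (incl S X) (congrArg (incl S) hX)
    exact ⟨r, hr, by
      change incl S _ ∈ matrixPos A p
      rw [incl_unit]
      exact h⟩
  archimedean {p} X h := matrixPos_archimedean (incl S X) fun ε hε => by
    rw [← incl_unit]
    exact h ε hε

end OperatorSubsystem

/-! ### Duals of operator systems -/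

/-- The dual `S^d` of an operator system: the space of all linear functionals on `S`. (On a
finite-dimensional operator system every linear functional is bounded.) -/
def OpDual (S : Type*) [AddCommGroup S] [Module ℂ S] : Type _ := S →ₗ[ℂ] ℂ

namespace OpDual

section Basic

variable {S : Type*} [AddCommGroup S] [Module ℂ S]

instance : AddCommGroup (OpDual S) := inferInstanceAs (AddCommGroup (S →ₗ[ℂ] ℂ))

instance : Module ℂ (OpDual S) := inferInstanceAs (Module ℂ (S →ₗ[ℂ] ℂ))

instance : FunLike (OpDual S) S ℂ := inferInstanceAs (FunLike (S →ₗ[ℂ] ℂ) S ℂ)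

instance : LinearMapClass (OpDual S) ℂ S ℂ := inferInstanceAs (LinearMapClass (S →ₗ[ℂ] ℂ) ℂ S ℂ)

@[simp] theorem zero_apply (s : S) : (0 : OpDual S) s = 0 := rfl

@[simp] theorem add_apply (f g : OpDual S) (s : S) : (f + g) s = f s + g s := rfl

@[simp] theorem neg_apply (f : OpDual S) (s : S) : (-f) s = -f s := rfl

@[simp] theorem smul_apply (c : ℂ) (f : OpDual S) (s : S) : (c • f) s = c * f s := rfl

@[ext] theorem ext {f g : OpDual S} (h : ∀ s, f s = g s) : f = g := DFunLike.ext f g h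

theorem sum_apply {ι : Type*} (t : Finset ι) (f : ι → OpDual S) (s : S) :
    (∑ i ∈ t, f i) s = ∑ i ∈ t, f i s := by
  classical
  induction t using Finset.induction_on with
  | empty => simp
  | insert a t ha ih => rw [Finset.sum_insert ha, Finset.sum_insert ha, add_apply, ih]

variable [StarAddMonoid S] [StarModule ℂ S]

/-- The involution `f*(s) = conj (f (s*))`. -/
instance : Star (OpDual S) :=
  ⟨fun f => ({ toFun := fun s => star (f (star s))
               map_add' := fun s t => by simp
               map_smul' := fun c s => by simp [mul_comm] } : S →ₗ[ℂ] ℂ)⟩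

@[simp] theorem star_apply (f : OpDual S) (s : S) : (star f) s = star (f (star s)) := rfl

instance : StarAddMonoid (OpDual S) where
  star_involutive f := by ext s; simp
  star_add f g := by ext s; simp

instance : StarModule ℂ (OpDual S) where
  star_smul c f := by ext s; simp

end Basic

/-- For `G = [g_ij] ∈ M_p(S^d)`, the amplification to `M_q(S)` of the associated map
`Ĝ : S → M_p`, `Ĝ(s) = [g_ij(s)]`: the matrix `X = [x_kl]` is sent to `[Ĝ(x_kl)] ∈ M_q(M_p)`,
written as a scalar matrix indexed by `Fin q × Fin p`. -/
def hat {S : Type*} [AddCommGroup S] [Module ℂ S] {p q : ℕ}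
    (G : Matrix (Fin p) (Fin p) (OpDual S)) (X : Matrix (Fin q) (Fin q) S) :
    Matrix (Fin q × Fin p) (Fin q × Fin p) ℂ :=
  fun a b => G a.2 b.2 (X a.1 b.1)

section Cones

variable {S : Type*} [AddCommGroup S] [Module ℂ S] [StarAddMonoid S] [StarModule ℂ S]
  [OperatorSystem S]

/-- `M_p(S^d)_+`: the matrices `G` for which `Ĝ : S → M_p` is completely positive. -/
def posCone (S : Type*) [AddCommGroup S] [Module ℂ S] [StarAddMonoid S] [StarModule ℂ S]
    [OperatorSystem S] (p : ℕ) : Set (Matrix (Fin p) (Fin p) (OpDual S)) :=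
  {G | ∀ (q : ℕ) (X : Matrix (Fin q) (Fin q) S),
    X ∈ MatrixOrderedSpace.pos q → (hat G X).PosSemidef}

/-- Functionals that agree on the positive elements are equal. -/
theorem eq_of_eq_on_pos {f g : OpDual S}
    (h : ∀ x : S, (Matrix.of fun _ _ => x : Matrix (Fin 1) (Fin 1) S) ∈
      MatrixOrderedSpace.pos 1 → f x = g x) : f = g := by
  have hsa : ∀ x : S, star x = x → f x = g x := by
    intro x hx
    obtain ⟨r, hr, h1⟩ := OperatorSystem.order_unit
      (Matrix.of fun _ _ => x : Matrix (Fin 1) (Fin 1) S) (by ext i j; simpa using hx)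
    obtain ⟨t, ht, h2⟩ := OperatorSystem.order_unit (0 : Matrix (Fin 1) (Fin 1) S) (by simp)
    have e1 : (r : ℂ) • diagUnit 1 (OperatorSystem.unit : S) + Matrix.of (fun _ _ => x) =
        Matrix.of fun _ _ => (r : ℂ) • (OperatorSystem.unit : S) + x := by
      ext i j
      simp [diagUnit, Subsingleton.elim i j]
    have e2 : (t : ℂ) • diagUnit 1 (OperatorSystem.unit : S) + 0 =
        Matrix.of fun _ _ => (t : ℂ) • (OperatorSystem.unit : S) := by
      ext i j
      simp [diagUnit, Subsingleton.elim i j]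
    rw [e1] at h1
    rw [e2] at h2
    have h1' := h _ h1
    have h2' := h _ h2
    simp only [map_add, map_smul, smul_eq_mul] at h1' h2'
    have ht' : (t : ℂ) ≠ 0 := by exact_mod_cast ht.ne'
    rw [mul_left_cancel₀ ht' h2'] at h1'
    exact add_left_cancel h1'
  ext s
  have hre : star (realPart s : S) = realPart s := (realPart s).2
  have him : star (imaginaryPart s : S) = imaginaryPart s := (imaginaryPart s).2
  rw [← realPart_add_I_smul_imaginaryPart s]
  simp [hsa _ hre, hsa _ him]

/-- The dual of an operator system as a matricially ordered space. -/
instance instMatrixOrderedSpace : MatrixOrderedSpace (OpDual S) where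
  pos p := posCone S p
  selfAdjoint_of_pos {p G} hG := by
    ext i j : 1
    refine eq_of_eq_on_pos fun x hx => ?_
    have h := (hG 1 _ hx).isHermitian
    have h' := congrFun (congrFun h (0, i)) (0, j)
    have hs : star x = x := by
      simpa using congrFun (congrFun (MatrixOrderedSpace.selfAdjoint_of_pos hx) 0) 0
    simpa [hat, hs] using h'
  zero_pos p q X _ := by
    have : hat (0 : Matrix (Fin p) (Fin p) (OpDual S)) X = 0 := by ext; simp [hat]
    rw [this]
    exact Matrix.PosSemidef.zero
  add_pos {p G H} hG hH q X hX := by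
    have : hat (G + H) X = hat G X + hat H X := by ext; simp [hat]
    rw [this]
    exact (hG q X hX).add (hH q X hX)
  proper {p G} hG hH := by
    ext i j : 1
    refine eq_of_eq_on_pos fun x hx => ?_
    have h1 := (hG 1 _ hx)
    have h2 := (hH 1 _ hx)
    have e : hat (-G) (Matrix.of fun _ _ => x : Matrix (Fin 1) (Fin 1) S) =
        -hat G (Matrix.of fun _ _ => x) := by ext; simp [hat]
    rw [e] at h2
    have h3 : hat G (Matrix.of fun _ _ => x : Matrix (Fin 1) (Fin 1) S) = 0 := by
      open scoped MatrixOrder in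
      exact le_antisymm (neg_nonneg.1 (Matrix.nonneg_iff_posSemidef.2 h2))
        (Matrix.nonneg_iff_posSemidef.2 h1)
    simpa [hat] using congrFun (congrFun h3 (0, i)) (0, j)
  compress_pos {p r} α {G} hG q X hX := by
    have key : hat (compress α G) X =
        (Matrix.of fun (a : Fin q × Fin p) (b : Fin q × Fin r) =>
          if a.1 = b.1 then α a.2 b.2 else 0)ᴴ * hat G X *
        (Matrix.of fun (a : Fin q × Fin p) (b : Fin q × Fin r) =>
          if a.1 = b.1 then α a.2 b.2 else 0) := by
      ext ⟨k, i⟩ ⟨l, j⟩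
      simp only [hat, compress, Matrix.mul_apply, Matrix.conjTranspose_apply, Matrix.of_apply,
        Fintype.sum_prod_type, Finset.sum_mul, sum_apply, smul_apply]
      rw [Finset.sum_comm]
      rw [Finset.sum_eq_single l]
      · refine Finset.sum_congr rfl fun b _ => ?_
        rw [Finset.sum_eq_single k]
        · refine Finset.sum_congr rfl fun a _ => ?_
          simp
          ring
        · intro k' _ hk
          simp [hk]
        · simp
      · intro l' _ hl
        simp [hl]
      · simp
    rw [key]
    exact (hG q X hX).conjTranspose_mul_mul_same _

end Cones

end OpDual

/-! ### The full group C⋆-algebra and the universal unitaries -/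

/-- A unitary representation of a group on a nonzero complex Hilbert space. -/
structure UnitaryRep (G : Type*) [Group G] where
  /-- the Hilbert space -/
  space : Type
  [normedAddCommGroup : NormedAddCommGroup space]
  [innerProductSpace : InnerProductSpace ℂ space]
  [completeSpace : CompleteSpace space]
  [nontrivial : Nontrivial space]
  /-- the representation -/
  rep : G →* unitary (space →L[ℂ] space)

attribute [instance] UnitaryRep.normedAddCommGroup UnitaryRep.innerProductSpace
  UnitaryRep.completeSpace UnitaryRep.nontrivial

variable {G : Type} [Group G]

/-- The bounded operators on the space of a representation. -/
abbrev UnitaryRep.Op (π : UnitaryRep G) : Type := π.space →L[ℂ] π.space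

/-- The C⋆-algebra of all bounded families of operators `(T_π)_π`, `T_π ∈ B(H_π)`, where `π` runs
over all unitary representations of `G`, with the supremum norm. -/
abbrev UnivProd (G : Type) [Group G] : Type 1 := lp (fun π : UnitaryRep G => π.Op) ∞

instance : CStarAlgebra (UnivProd G) where

/-- The image of a group element in the universal representation `g ↦ (π(g))_π`. -/
def univElem (g : G) : UnivProd G :=
  ⟨fun π => (π.rep g : π.Op), memℓp_infty ⟨1, by
    rintro _ ⟨π, rfl⟩
    exact (CStarRing.norm_coe_unitary (π.rep g)).le⟩⟩

/-- The full group C⋆-algebra `C*(G)` of a discrete group: the closed unital `*`-subalgebra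
generated by the image of `G` under the universal representation. Equivalently, the completion
of `ℂ[G]` in the norm `‖a‖ = sup_π ‖π(a)‖`. -/
def fullGroupSubalgebra (G : Type) [Group G] : StarSubalgebra ℂ (UnivProd G) :=
  (StarAlgebra.adjoin ℂ (Set.range (univElem (G := G)))).topologicalClosure

/-- `C*(G)` as a type. -/
def FullGroupCStar (G : Type) [Group G] : Type 1 := fullGroupSubalgebra G

instance : CStarAlgebra (FullGroupCStar G) :=
  haveI : IsClosed (fullGroupSubalgebra G : Set (UnivProd G)) :=
    StarSubalgebra.isClosed_topologicalClosure _
  inferInstanceAs (CStarAlgebra (fullGroupSubalgebra G))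

/-- The canonical image of a group element in `C*(G)`. -/
def groupElem (g : G) : FullGroupCStar G :=
  ⟨univElem g, StarSubalgebra.le_topologicalClosure _
    (StarAlgebra.subset_adjoin ℂ _ (Set.mem_range_self g))⟩

/-- The universal unitaries `u_1, …, u_m` generating `C*(F_m)`: the images of the free
generators. -/
def universalUnitary (m : ℕ) (j : Fin m) : FullGroupCStar (FreeGroup (Fin m)) :=
  groupElem (FreeGroup.of j)

/-! ### The operator systems -/

/-- `Span {1, u_j, u_j^* : 1 ≤ j ≤ m}` inside `C*(F_m)`. -/
def freeSystem (m : ℕ) : OperatorSubsystem (FullGroupCStar (FreeGroup (Fin m))) where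
  toSubmodule := Submodule.span ℂ
    ({1} ∪ Set.range (universalUnitary m) ∪ Set.range fun j => star (universalUnitary m j))
  one_mem' := Submodule.subset_span (by simp)
  star_mem' {a} ha := by
    change a ∈ Submodule.span ℂ _ at ha
    change star a ∈ Submodule.span ℂ _
    induction ha using Submodule.span_induction with
    | mem x hx =>
      refine Submodule.subset_span ?_
      rcases hx with (hx | ⟨j, rfl⟩) | ⟨j, rfl⟩
      · left; left
        rw [Set.mem_singleton_iff] at hx ⊢
        rw [hx, star_one]
      · right
        exact ⟨j, rfl⟩
      · left; right
        exact ⟨j, (star_star _).symm⟩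
    | zero => rw [star_zero]; exact Submodule.zero_mem _
    | add x y _ _ hx hy => rw [star_add]; exact Submodule.add_mem _ hx hy
    | smul c x _ hx => rw [star_smul]; exact Submodule.smul_mem _ _ hx

/-- The tridiagonal matrices in `M_n(ℂ)`. -/
def tridiagonalSystem (n : ℕ) : OperatorSubsystem (CStarMatrix (Fin n) (Fin n) ℂ) where
  carrier := {M | ∀ i j : Fin n, 2 ≤ |((i : ℕ) : ℤ) - ((j : ℕ) : ℤ)| → M i j = 0}
  zero_mem' _ _ _ := rfl
  add_mem' {M N} hM hN i j h := by rw [CStarMatrix.add_apply, hM i j h, hN i j h, add_zero]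
  smul_mem' c M hM i j h := by rw [CStarMatrix.smul_apply, hM i j h, smul_zero]
  one_mem' i j h := by
    rw [CStarMatrix.one_apply, if_neg]
    rintro rfl
    simp at h
  star_mem' {M} hM i j h := by
    rw [CStarMatrix.star_apply, hM j i (by rwa [abs_sub_comm]), star_zero]

/-- The C⋆-algebra `⊕_{k=1}^m M_2(ℂ)`. -/
abbrev SumM2 (m : ℕ) : Type := Fin m → CStarMatrix (Fin 2) (Fin 2) ℂ

/-- `V_n ⊆ ⊕_{k=1}^{n-1} M_2`: the lower right entry of each block is the upper left entry of the
next block. -/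
def systemV (n : ℕ) : OperatorSubsystem (SumM2 (n - 1)) where
  carrier := {a | ∀ k l : Fin (n - 1), (l : ℕ) = (k : ℕ) + 1 → a k 1 1 = a l 0 0}
  zero_mem' _ _ _ := rfl
  add_mem' {a b} ha hb k l h := by
    simp only [Pi.add_apply, CStarMatrix.add_apply, ha k l h, hb k l h]
  smul_mem' c a ha k l h := by
    simp only [Pi.smul_apply, CStarMatrix.smul_apply, ha k l h]
  one_mem' k l h := by simp
  star_mem' {a} ha k l h := by
    simp only [Pi.star_apply, CStarMatrix.star_apply, ha k l h]

/-- `U_n ⊆ ⊕_{k=1}^{n-1} M_2`: all diagonal entries of all blocks are equal. -/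
def systemU (n : ℕ) : OperatorSubsystem (SumM2 (n - 1)) where
  carrier := {a | ∀ (k l : Fin (n - 1)) (i j : Fin 2), a k i i = a l j j}
  zero_mem' _ _ _ _ := rfl
  add_mem' {a b} ha hb k l i j := by
    simp only [Pi.add_apply, CStarMatrix.add_apply, ha k l i j, hb k l i j]
  smul_mem' c a ha k l i j := by
    simp only [Pi.smul_apply, CStarMatrix.smul_apply, ha k l i j]
  one_mem' k l i j := by simp
  star_mem' {a} ha k l i j := by
    simp only [Pi.star_apply, CStarMatrix.star_apply, ha k l i j]

end OpSys

end

/-! Both dualities reduce to one fact: two finite families of vectors in a finite-dimensional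
Hilbert space with equal Gram matrices differ by a unitary
(`exists_linearIsometryEquiv_of_gram_eq`).

A functional on the tridiagonal matrices is a choice of values on the matrix units `E_ij` with `|i -
j| ≤ 1`, that is, of 2×2 blocks that overlap in diagonal entries; this is an element of `V_n`. If
`Ĝ` is completely positive, then block `k` of `G` is positive semidefinite, because the 2×2 array of
units `E_ij` with `i, j ∈ {k, k+1}` is positive. Conversely, positive semidefinite blocks are Gram
matrices. The overlap condition says that the second family of block `k` and the first family of
block `k+1` have the same Gram matrix, so unitaries glue them into one chain `v` with `G_ab(E_ij) =
⟪v_i a, v_j b⟫` on the band. This is positive semidefinite completion along a path: `Ĝ` is then the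
restriction of a completely positive map on all of `M_n`.

A functional on `S_m` is a choice of values at `1`, `u_k`, `u_k^*`, hence a point of `U_{m+1}`.
Positivity of `[1 u_k; u_k^* 1]` makes the blocks of a positive `G` positive semidefinite.
Conversely, all the families in the Gram realisations of the blocks have the Gram matrix
`[G_ab(1)]`, so they are unitary images of one family `v`. Comparing the two families of block `k`
yields a unitary `U_k` with `G_ab(u_k) = ⟪v_a, U_k v_b⟫`. Freeness turns the `U_k` into a
representation of `C*(F_m)`, and `Ĝ` is a matrix of vector functionals of it, hence completely
positive. -/

namespace OpSys

/-! ### Gram matrices and unitaries -/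

section Gram

variable {H : Type*} [NormedAddCommGroup H] [InnerProductSpace ℂ H]

/-- Two finite families with the same Gram matrix differ by a unitary. -/
theorem exists_linearIsometryEquiv_of_gram_eq [FiniteDimensional ℂ H] {ι : Type*} [Fintype ι]
    (r s : ι → H) (h : ∀ a b, inner ℂ (r a) (r b) = inner ℂ (s a) (s b)) :
    ∃ W : H ≃ₗᵢ[ℂ] H, ∀ a, W (r a) = s a := by
  classical
  let R := Fintype.linearCombination ℂ r
  let S := Fintype.linearCombination ℂ s
  have hRS : ∀ x, ‖R x‖ = ‖S x‖ := fun x => by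
    have : inner ℂ (R x) (R x) = inner ℂ (S x) (S x) := by
      simp only [R, S, Fintype.linearCombination_apply, sum_inner, inner_sum, inner_smul_left,
        inner_smul_right, h]
    rw [inner_self_eq_norm_sq_to_K, inner_self_eq_norm_sq_to_K] at this
    have h2 : ‖R x‖ ^ 2 = ‖S x‖ ^ 2 := by exact_mod_cast this
    exact (sq_eq_sq₀ (norm_nonneg _) (norm_nonneg _)).1 h2
  -- Equality of norms makes `R x ↦ S x` a well-defined isometry on the range of `R`.
  have hker : LinearMap.ker R ≤ LinearMap.ker S := fun x hx => by
    rw [LinearMap.mem_ker] at hx ⊢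
    rw [← norm_eq_zero, ← hRS, hx, norm_zero]
  let L : LinearMap.range R →ₗ[ℂ] H :=
    (LinearMap.ker R).liftQ S hker ∘ₗ (R.quotKerEquivRange.symm : LinearMap.range R →ₗ[ℂ] _)
  have hL : ∀ x, L ⟨R x, LinearMap.mem_range_self R x⟩ = S x := fun x => by
    simp only [L, LinearMap.comp_apply, LinearEquiv.coe_coe]
    rw [LinearMap.quotKerEquivRange_symm_apply_image, Submodule.mkQ_apply, Submodule.liftQ_apply]
  let LI : LinearMap.range R →ₗᵢ[ℂ] H :=
    { L with
      norm_map' := by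
        rintro ⟨_, x, rfl⟩
        exact (congrArg norm (hL x)).trans (hRS x).symm }
  -- In finite dimension an isometry of a subspace into `H` extends to all of `H`, and the extension
  -- is onto.
  refine ⟨LI.extend.toLinearIsometryEquiv rfl, fun a => ?_⟩
  have hr : R (Pi.single a 1) = r a := by simp [R]
  have hs : S (Pi.single a 1) = s a := by simp [S]
  rw [LinearIsometry.coe_toLinearIsometryEquiv, ← hr, ← hs, ← hL]
  exact LI.extend_apply ⟨R _, LinearMap.mem_range_self R _⟩

/-- Pairs of families `(r k, s k)` such that the Gram matrices of `s k` and `r (k + 1)` agree can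
be moved by unitaries so as to be consecutive members of one sequence of families. -/
theorem exists_chain_of_gram_eq [FiniteDimensional ℂ H] {ι : Type*} [Fintype ι] {m : ℕ}
    (r s : Fin m → ι → H) (w : ι → H)
    (h : ∀ k l : Fin m, (l : ℕ) = k + 1 → ∀ a b,
      inner ℂ (r l a) (r l b) = inner ℂ (s k a) (s k b))
    (hw : ∀ k : Fin m, (k : ℕ) = 0 → ∀ a b, inner ℂ (r k a) (r k b) = inner ℂ (w a) (w b)) :
    ∃ v : Fin (m + 1) → ι → H, v 0 = w ∧ ∀ k : Fin m, ∃ W : H ≃ₗᵢ[ℂ] H,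
      ∀ a, v k.castSucc a = W (r k a) ∧ v k.succ a = W (s k a) := by
  induction m generalizing w with
  | zero => exact ⟨fun _ => w, rfl, fun k => k.elim0⟩
  | succ m ih =>
    -- The prescribed initial family `w` serves the induction: the remaining chain must start at `W
    -- (s 0)`, whose Gram matrix is that of `s 0`, hence that of `r 1`.
    obtain ⟨W, hW⟩ := exists_linearIsometryEquiv_of_gram_eq (r 0) w (hw 0 rfl)
    obtain ⟨v, hv0, hv⟩ := ih (fun k => r k.succ) (fun k => s k.succ) (fun a => W (s 0 a))
      (fun k l hkl => h _ _ (by simpa using hkl)) (fun k hk a b => by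
        rw [h 0 k.succ (by simp [hk]), W.inner_map_map])
    refine ⟨Fin.cons w v, rfl, Fin.cases ⟨W, fun a => ⟨(hW a).symm, ?_⟩⟩ fun k => ?_⟩
    · simp [hv0]
    · obtain ⟨W', hW'⟩ := hv k
      exact ⟨W', fun a => by simpa using hW' a⟩

theorem posSemidef_of_eq_sum_inner {ι κ : Type*} [Fintype ι] [Finite κ] {M : Matrix κ κ ℂ}
    (w : ι → κ → H) (h : ∀ x y, M x y = ∑ i, inner ℂ (w i x) (w i y)) : M.PosSemidef := by
  have : M = ∑ i, Matrix.gram ℂ (w i) := by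
    ext x y
    simp [h, Matrix.sum_apply]
  rw [this]
  exact Matrix.posSemidef_sum _ fun i _ => Matrix.posSemidef_gram ℂ (w i)

/-- The vectors are the columns of `C` in a factorization `M = Cᴴ C`. Their space depends only on
`κ`, so realisations of different blocks can be compared by unitaries of a single space. -/
theorem exists_inner_of_posSemidef {κ : Type*} [Fintype κ] {M : Matrix κ κ ℂ}
    (hM : M.PosSemidef) : ∃ c : κ → EuclideanSpace ℂ κ, ∀ x y, M x y = inner ℂ (c x) (c y) := by
  classical
  open scoped MatrixOrder in
  obtain ⟨C, rfl⟩ := CStarAlgebra.nonneg_iff_eq_star_mul_self.1 (Matrix.nonneg_iff_posSemidef.2 hM)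
  refine ⟨fun x => WithLp.toLp 2 fun z => C z x, fun x y => ?_⟩
  simp [Matrix.mul_apply, PiLp.inner_apply, Matrix.star_eq_conjTranspose, mul_comm]

end Gram

/-! ### Positive cones over sums of `M₂` and complete order isomorphisms -/

theorem cstarMatrix_sum_apply {ι m n : Type*} [Fintype ι] (f : ι → CStarMatrix m n ℂ) (i : m)
    (j : n) : (∑ c, f c) i j = ∑ c, f c i j :=
  Matrix.sum_apply i j Finset.univ f

/-- The `k`-th block of a matrix over `⊕ M₂` as a scalar matrix. -/
def sumBlock {m p : ℕ} (Y : Matrix (Fin p) (Fin p) (SumM2 m)) (k : Fin m) :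
    Matrix (Fin 2 × Fin p) (Fin 2 × Fin p) ℂ :=
  fun x y => Y x.2 y.2 k x.1 y.1

/-- This is the canonical shuffle `M_p(⊕ M₂) ≅ ⊕ M_{2p}`: a factorization `Bᴴ B` exists exactly when
one exists in each block separately. -/
theorem mem_matrixPos_sumM2_iff {m p : ℕ} (Y : Matrix (Fin p) (Fin p) (SumM2 m)) :
    Y ∈ matrixPos (SumM2 m) p ↔ ∀ k, (sumBlock Y k).PosSemidef := by
  have hsum : ∀ (B : Matrix (Fin p) (Fin p) (SumM2 m)) a b k i j, (Bᴴ * B) a b k i j =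
      ∑ c, ∑ l, star (B c a k l i) * B c b k l j := fun B a b k i j => by
    simp only [Matrix.mul_apply, Finset.sum_apply, cstarMatrix_sum_apply]
    rfl
  constructor
  · rintro ⟨B, rfl⟩ k
    have : sumBlock (Bᴴ * B) k = (sumBlock B k)ᴴ * sumBlock B k := by
      ext ⟨i, a⟩ ⟨j, b⟩
      simp only [sumBlock, hsum, Matrix.mul_apply, Matrix.conjTranspose_apply,
        Fintype.sum_prod_type]
      exact Finset.sum_comm
    rw [this]
    exact Matrix.posSemidef_conjTranspose_mul_self _
  · intro h
    open scoped MatrixOrder in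
    choose C hC using fun k =>
      CStarAlgebra.nonneg_iff_eq_star_mul_self.1 (Matrix.nonneg_iff_posSemidef.2 (h k))
    refine ⟨Matrix.of fun a b k => CStarMatrix.ofMatrix fun i j => C k (i, a) (j, b), ?_⟩
    ext a b : 1
    funext k
    ext i j
    rw [hsum]
    have := congrFun (congrFun (hC k) (i, a)) (j, b)
    simp only [sumBlock] at this
    rw [this, Matrix.mul_apply, Fintype.sum_prod_type, Finset.sum_comm]
    rfl

/-- A linear bijection that preserves and reflects the positive cones is a complete order
isomorphism. -/
theorem completelyOrderIsomorphic_of_bijective {V W : Type*} [AddCommGroup V] [Module ℂ V]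
    [StarAddMonoid V] [StarModule ℂ V] [MatrixOrderedSpace V] [AddCommGroup W] [Module ℂ W]
    [StarAddMonoid W] [StarModule ℂ W] [MatrixOrderedSpace W] (φ : V →ₗ[ℂ] W)
    (hφ : Function.Bijective φ)
    (h : ∀ (p : ℕ) (X : Matrix (Fin p) (Fin p) V),
      X ∈ MatrixOrderedSpace.pos p ↔ X.map φ ∈ MatrixOrderedSpace.pos p) :
    CompletelyOrderIsomorphic V W := by
  refine ⟨LinearEquiv.ofBijective φ hφ, fun p X hX => (h p X).1 hX, fun p X hX => (h p _).2 ?_⟩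
  convert hX
  ext i j
  exact (LinearEquiv.ofBijective φ hφ).apply_symm_apply (X i j)


/-! ### The dual of the tridiagonal matrices -/

/-- The matrix unit `E_ij` as a tridiagonal matrix; junk value `0` if `|i - j| ≥ 2`. -/
def triUnit {n : ℕ} (i j : Fin n) : tridiagonalSystem n :=
  ⟨if |((i : ℕ) : ℤ) - ((j : ℕ) : ℤ)| < 2 then
      CStarMatrix.ofMatrix (Matrix.single i j 1) else 0, by
    intro a b hab
    split_ifs with h
    · refine Matrix.single_apply_of_ne _ _ _ _ _ ?_
      rintro ⟨rfl, rfl⟩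
      omega
    · rfl⟩

theorem coe_triUnit {n : ℕ} {i j : Fin n} (h : |((i : ℕ) : ℤ) - ((j : ℕ) : ℤ)| < 2) :
    (triUnit i j : CStarMatrix (Fin n) (Fin n) ℂ) = CStarMatrix.ofMatrix (Matrix.single i j 1) :=
  if_pos h

theorem eq_sum_triUnit {n : ℕ} (X : tridiagonalSystem n) :
    X = ∑ i, ∑ j, (X : CStarMatrix (Fin n) (Fin n) ℂ) i j • triUnit i j := by
  refine Subtype.ext ?_
  ext a b
  simp only [AddSubmonoidClass.coe_finsetSum, cstarMatrix_sum_apply, Submodule.coe_smul,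
    CStarMatrix.smul_apply]
  by_cases h : |((a : ℕ) : ℤ) - ((b : ℕ) : ℤ)| < 2
  · rw [Finset.sum_eq_single a, Finset.sum_eq_single b]
    · simp [coe_triUnit h]
    · intro j _ hj
      by_cases h' : |((a : ℕ) : ℤ) - ((j : ℕ) : ℤ)| < 2
      · simp [coe_triUnit h', hj]
      · simp [triUnit, h']
    · simp
    · intro i _ hi
      refine Finset.sum_eq_zero fun j _ => ?_
      by_cases h' : |((i : ℕ) : ℤ) - ((j : ℕ) : ℤ)| < 2
      · simp [coe_triUnit h', hi]
      · simp [triUnit, h']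
    · simp
  · rw [X.2 a b (not_lt.1 h)]
    refine (Finset.sum_eq_zero fun i _ => Finset.sum_eq_zero fun j _ => ?_).symm
    have := (triUnit i j).2 a b (not_lt.1 h)
    rw [this, smul_zero]

theorem dual_apply_eq_sum {n : ℕ} (f : OpDual (tridiagonalSystem n)) (X : tridiagonalSystem n) :
    f X = ∑ i, ∑ j, (X : CStarMatrix (Fin n) (Fin n) ℂ) i j * f (triUnit i j) := by
  conv_lhs => rw [eq_sum_triUnit X]
  simp [map_sum, map_smul]

/-- The index of the `i`-th row of the `k`-th block. -/
def blockIndex {m : ℕ} (k : Fin m) (i : Fin 2) : Fin (m + 1) :=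
  ⟨k + i, by omega⟩

theorem blockIndex_close {m : ℕ} (k : Fin m) (i j : Fin 2) :
    |((blockIndex k i : ℕ) : ℤ) - ((blockIndex k j : ℕ) : ℤ)| < 2 := by
  simp only [blockIndex]
  rw [abs_lt]
  constructor <;> push_cast <;> omega

theorem exists_blockIndex {m : ℕ} (hm : 0 < m) {a b : Fin (m + 1)}
    (h : |((a : ℕ) : ℤ) - ((b : ℕ) : ℤ)| < 2) :
    ∃ (k : Fin m) (i j : Fin 2), a = blockIndex k i ∧ b = blockIndex k j := by
  rw [abs_lt] at h
  by_cases hab : (a : ℕ) = b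
  · by_cases ha : (a : ℕ) < m
    · exact ⟨⟨a, ha⟩, 0, 0, by ext; simp [blockIndex], by ext; simp [blockIndex, hab]⟩
    -- The last diagonal index `m` starts no block, so it is the lower right corner of block `m -
    -- 1`.
    · exact ⟨⟨m - 1, by omega⟩, 1, 1, by ext; simp [blockIndex]; omega,
        by ext; simp [blockIndex]; omega⟩
  · by_cases h' : (a : ℕ) < b
    · exact ⟨⟨a, by omega⟩, 0, 1, by ext; simp [blockIndex], by ext; simp [blockIndex]; omega⟩
    · exact ⟨⟨b, by omega⟩, 1, 0, by ext; simp [blockIndex]; omega, by ext; simp [blockIndex]⟩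

/-- The map `T_{m+1}^d → V_{m+1}` that records the values on matrix units blockwise. -/
noncomputable def tridiagonalDualMap (m : ℕ) : OpDual (tridiagonalSystem (m + 1)) →ₗ[ℂ] systemV (m + 1) where
  toFun f := ⟨fun k => CStarMatrix.ofMatrix fun i j =>
      f (triUnit (blockIndex (m := m) k i) (blockIndex (m := m) k j)), by
    intro k l h
    have : blockIndex (m := m) k 1 = blockIndex (m := m) l 0 := by
      ext
      simp [blockIndex, h]
    change f (triUnit (blockIndex (m := m) k 1) (blockIndex (m := m) k 1)) = _
    rw [this]
    rfl⟩
  map_add' _ _ := rfl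
  map_smul' _ _ := rfl

theorem tridiagonalDualMap_apply {m : ℕ} (f : OpDual (tridiagonalSystem (m + 1))) (k : Fin m)
    (i j : Fin 2) : (tridiagonalDualMap m f).1 k i j =
      f (triUnit (blockIndex k i) (blockIndex k j)) := rfl

/-- Distinct blocks overlap only if they are consecutive, and then in a single diagonal position,
where the condition defining `V` applies. Hence an element of `V` has well-defined entries on the
band. -/
theorem systemV_apply_eq {m : ℕ} {y : SumM2 m} (hy : y ∈ (systemV (m + 1)).toSubmodule)
    {k l : Fin m} {i j i' j' : Fin 2} (h : blockIndex k i = blockIndex l i')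
    (h' : blockIndex k j = blockIndex l j') : y k i j = y l i' j' := by
  have h1 := congrArg Fin.val h
  have h2 := congrArg Fin.val h'
  simp only [blockIndex] at h1 h2
  have hV : ∀ k l : Fin m, (l : ℕ) = k + 1 → y k 1 1 = y l 0 0 := hy
  by_cases hkl : k = l
  · subst hkl
    congr 1 <;> omega
  have hkl' : (k : ℕ) ≠ l := fun h => hkl (Fin.ext h)
  rcases Nat.lt_or_gt_of_ne hkl' with hlt | hlt
  · obtain rfl : i = 1 := by omega
    obtain rfl : j = 1 := by omega
    obtain rfl : i' = 0 := by omega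
    obtain rfl : j' = 0 := by omega
    exact hV k l (by simpa using h1.symm)
  · obtain rfl : i = 0 := by omega
    obtain rfl : j = 0 := by omega
    obtain rfl : i' = 1 := by omega
    obtain rfl : j' = 1 := by omega
    exact (hV l k (by simpa using h1)).symm

theorem tridiagonalDualMap_bijective {m : ℕ} (hm : 0 < m) :
    Function.Bijective (tridiagonalDualMap m) := by
  constructor
  · refine (injective_iff_map_eq_zero _).2 fun f hf => ?_
    have hf' : ∀ (k : Fin m) (i j : Fin 2), f (triUnit (blockIndex k i) (blockIndex k j)) = 0 :=
      fun k i j => by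
        rw [← tridiagonalDualMap_apply, hf]
        rfl
    ext X
    rw [dual_apply_eq_sum]
    refine Finset.sum_eq_zero fun a _ => Finset.sum_eq_zero fun b _ => ?_
    by_cases h : |((a : ℕ) : ℤ) - ((b : ℕ) : ℤ)| < 2
    · obtain ⟨k, i, j, rfl, rfl⟩ := exists_blockIndex hm h
      rw [hf', mul_zero]
    · rw [X.2 a b (not_lt.1 h), zero_mul]
  · rintro ⟨y, hy⟩
    classical
    -- An interior diagonal position lies in two blocks and one is chosen arbitrarily; `hc` shows
    -- that the choice does not matter.
    let c : Fin (m + 1) → Fin (m + 1) → ℂ := fun a b =>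
      if h : |((a : ℕ) : ℤ) - ((b : ℕ) : ℤ)| < 2 then
        let e := exists_blockIndex hm h
        (y : SumM2 m) e.choose e.choose_spec.choose e.choose_spec.choose_spec.choose
      else 0
    have hc : ∀ (k : Fin m) (i j : Fin 2),
        c (blockIndex k i) (blockIndex k j) = (y : SumM2 m) k i j := fun k i j => by
      have e := exists_blockIndex hm (blockIndex_close k i j)
      have hs := e.choose_spec.choose_spec.choose_spec
      simp only [c, dif_pos (blockIndex_close k i j)]
      exact (systemV_apply_eq hy hs.1 hs.2).symm
    let f : tridiagonalSystem (m + 1) →ₗ[ℂ] ℂ :=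
      { toFun := fun X => ∑ a, ∑ b, (X : CStarMatrix (Fin (m + 1)) (Fin (m + 1)) ℂ) a b * c a b
        map_add' := fun X Y => by
          simp [add_mul, Finset.sum_add_distrib]
        map_smul' := fun t X => by
          simp [mul_assoc, Finset.mul_sum] }
    refine ⟨f, Subtype.ext (funext fun k => ?_)⟩
    ext i j
    refine Eq.trans ?_ (hc k i j)
    change ∑ a, ∑ b, (triUnit (blockIndex (m := m) k i) (blockIndex (m := m) k j) :
      CStarMatrix (Fin (m + 1)) (Fin (m + 1)) ℂ) a b * c a b = _
    rw [coe_triUnit (blockIndex_close k i j)]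
    simp [Matrix.single_apply, ite_and]

/-- With `X = Bᴴ B`, bilinear expansion turns `G_ab(X_kl)` into a sum of inner products of the
vectors `∑ i, B_xk(z, i) v_i a` over pairs `(x, z)`, so `hat G X` is a sum of Gram matrices. The
factor `B` need not be tridiagonal. -/
theorem hat_posSemidef_of_chain {m p q : ℕ} {H : Type*} [NormedAddCommGroup H]
    [InnerProductSpace ℂ H] {G : Matrix (Fin p) (Fin p) (OpDual (tridiagonalSystem m))}
    (v : Fin m → Fin p → H)
    (hv : ∀ (i j : Fin m) a b, |((i : ℕ) : ℤ) - ((j : ℕ) : ℤ)| < 2 →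
      G a b (triUnit i j) = inner ℂ (v i a) (v j b))
    {X : Matrix (Fin q) (Fin q) (tridiagonalSystem m)} (hX : X ∈ MatrixOrderedSpace.pos q) :
    (OpDual.hat G X).PosSemidef := by
  obtain ⟨B, hB⟩ := hX
  refine posSemidef_of_eq_sum_inner
    (fun (x : Fin q × Fin m) (y : Fin q × Fin p) => ∑ i, B x.1 y.1 x.2 i • v i y.2) ?_
  rintro ⟨k, a⟩ ⟨l, b⟩
  have hX' : ∀ i j, (X k l : CStarMatrix (Fin m) (Fin m) ℂ) i j =
      ∑ x : Fin q × Fin m, star (B x.1 k x.2 i) * B x.1 l x.2 j := fun i j => by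
    have : (X k l : CStarMatrix (Fin m) (Fin m) ℂ) = (Bᴴ * B) k l := congrFun (congrFun hB k) l
    rw [this, Fintype.sum_prod_type]
    simp only [Matrix.mul_apply, cstarMatrix_sum_apply, CStarMatrix.mul_apply]
    rfl
  have key : ∀ i j, (X k l : CStarMatrix (Fin m) (Fin m) ℂ) i j * G a b (triUnit i j) =
      ∑ x : Fin q × Fin m, inner ℂ (B x.1 k x.2 i • v i a) (B x.1 l x.2 j • v j b) := by
    intro i j
    -- Off the band `⟪v i a, v j b⟫` is unconstrained, but there the entry of `X k l` vanishes.
    have : (X k l : CStarMatrix (Fin m) (Fin m) ℂ) i j * G a b (triUnit i j) =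
        (X k l : CStarMatrix (Fin m) (Fin m) ℂ) i j * inner ℂ (v i a) (v j b) := by
      by_cases h : |((i : ℕ) : ℤ) - ((j : ℕ) : ℤ)| < 2
      · rw [hv i j a b h]
      · rw [(X k l).2 i j (not_lt.1 h), zero_mul, zero_mul]
    rw [this, hX', Finset.sum_mul]
    refine Finset.sum_congr rfl fun x _ => ?_
    rw [inner_smul_left, inner_smul_right, starRingEnd_apply, mul_assoc]
  change G a b (X k l) = _
  rw [dual_apply_eq_sum]
  simp only [key, sum_inner, inner_sum]
  exact (Finset.sum_congr rfl fun _ _ => Finset.sum_comm).trans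
    (Finset.sum_comm.trans (Finset.sum_congr rfl fun _ _ => Finset.sum_comm))

theorem tridiagonalDual_pos_iff {m p : ℕ} (hm : 0 < m)
    (G : Matrix (Fin p) (Fin p) (OpDual (tridiagonalSystem (m + 1)))) :
    G ∈ MatrixOrderedSpace.pos p ↔ G.map (tridiagonalDualMap m) ∈ MatrixOrderedSpace.pos p := by
  change _ ↔ OperatorSubsystem.incl _ (G.map (tridiagonalDualMap m)) ∈ matrixPos (SumM2 m) p
  rw [mem_matrixPos_sumM2_iff]
  have hblock : ∀ (k : Fin m) x y, sumBlock (m := m)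
      (OperatorSubsystem.incl _ (G.map (tridiagonalDualMap m))) k x y =
      G x.2 y.2 (triUnit (blockIndex k x.1) (blockIndex k y.1)) := fun _ _ _ => rfl
  constructor
  · intro hG k
    refine hG 2 (Matrix.of fun i j => triUnit (blockIndex k i) (blockIndex k j)) ?_
    change OperatorSubsystem.incl _ _ ∈ matrixPos _ _
    -- The array of units factors through the row `R = [E_{0,k} E_{0,k+1}]`, since `E_{0,i}ᴴ E_{0,j}
    -- = E_{i,j}`.
    have : OperatorSubsystem.incl (tridiagonalSystem (m + 1))
        (Matrix.of fun i j => triUnit (blockIndex k i) (blockIndex k j)) =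
        (Matrix.of fun (_ : Fin 1) i => CStarMatrix.ofMatrix
          (Matrix.single (0 : Fin (m + 1)) (blockIndex k i) (1 : ℂ)))ᴴ *
        (Matrix.of fun (_ : Fin 1) i => CStarMatrix.ofMatrix
          (Matrix.single (0 : Fin (m + 1)) (blockIndex k i) (1 : ℂ))) := by
      ext i j : 1
      simp only [OperatorSubsystem.incl, Matrix.map_apply, Matrix.of_apply, Matrix.mul_apply,
        Matrix.conjTranspose_apply, Finset.univ_unique, Finset.sum_singleton,
        coe_triUnit (blockIndex_close k i j)]
      change _ = (Matrix.single (0 : Fin (m + 1)) (blockIndex k i) (1 : ℂ))ᴴ *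
        Matrix.single (0 : Fin (m + 1)) (blockIndex k j) (1 : ℂ)
      rw [Matrix.conjTranspose_single, Matrix.single_mul_single_same]
      simp
      rfl
    rw [this]
    exact matrixPos_conj _
  · intro h q X hX
    choose c hc using fun k => exists_inner_of_posSemidef (h k)
    -- The start of the chain is immaterial here; the first family of block `0` satisfies the Gram
    -- condition trivially.
    obtain ⟨v, -, hv⟩ := exists_chain_of_gram_eq (fun k a => c k (0, a)) (fun k a => c k (1, a))
      (fun a => c ⟨0, hm⟩ (0, a)) (fun k l hkl a b => by
        rw [← hc, ← hc, hblock, hblock]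
        have : blockIndex k 1 = blockIndex l 0 := by
          ext
          simp [blockIndex, hkl]
        simp only [this]) (fun k hk a b => by
        obtain rfl : k = ⟨0, hm⟩ := Fin.ext hk
        rfl)
    refine hat_posSemidef_of_chain v (fun i j a b hij => ?_) hX
    obtain ⟨k, i, j, rfl, rfl⟩ := exists_blockIndex hm hij
    obtain ⟨W, hW⟩ := hv k
    have hW' : ∀ (i : Fin 2) a, v (blockIndex k i) a = W (c k (i, a)) := fun i a => by
      fin_cases i
      · exact (hW a).1
      · exact (hW a).2
    rw [hW', hW', W.inner_map_map, ← hc, hblock]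

theorem tridiagonalDual_completelyOrderIsomorphic {m : ℕ} (hm : 0 < m) :
    CompletelyOrderIsomorphic (OpDual (tridiagonalSystem (m + 1))) (systemV (m + 1)) :=
  completelyOrderIsomorphic_of_bijective (tridiagonalDualMap m) (tridiagonalDualMap_bijective hm)
    fun _ G => tridiagonalDual_pos_iff hm G


/-! ### The dual of the span of the free unitaries -/

/-- The `*`-homomorphism `C*(G) → B(H_π)` induced by a unitary representation `π`. -/
noncomputable def evalRep {G : Type} [Group G] (π : UnitaryRep G) : FullGroupCStar G →⋆ₐ[ℂ] π.Op where
  toFun x := x.1.1 π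
  map_one' := rfl
  map_mul' _ _ := rfl
  map_zero' := rfl
  map_add' _ _ := rfl
  commutes' _ := rfl
  map_star' _ := rfl

section FreeEval

variable {m : ℕ} {H : Type} [NormedAddCommGroup H] [InnerProductSpace ℂ H] [CompleteSpace H]
  [Nontrivial H]

/-- The representation of a free group sending the generators to given unitaries. -/
noncomputable def freeRep (U : Fin m → H ≃ₗᵢ[ℂ] H) : UnitaryRep (FreeGroup (Fin m)) where
  space := H
  rep := FreeGroup.lift fun k => Unitary.linearIsometryEquiv.symm (U k)

/-- The `*`-homomorphism on `C*(F_m)` sending the universal unitaries to given unitaries. -/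
noncomputable def freeEval (U : Fin m → H ≃ₗᵢ[ℂ] H) :
    FullGroupCStar (FreeGroup (Fin m)) →⋆ₐ[ℂ] (H →L[ℂ] H) :=
  evalRep (freeRep U)

theorem freeEval_universalUnitary (U : Fin m → H ≃ₗᵢ[ℂ] H) (k : Fin m) (x : H) :
    freeEval U (universalUnitary m k) x = U k x := by
  change ((FreeGroup.lift fun k => Unitary.linearIsometryEquiv.symm (U k))
    (FreeGroup.of k) : H →L[ℂ] H) x = _
  rw [FreeGroup.lift_apply_of]
  rfl

theorem inner_freeEval_star (U : Fin m → H ≃ₗᵢ[ℂ] H) (s : FullGroupCStar (FreeGroup (Fin m)))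
    (x y : H) : inner ℂ x (freeEval U (star s) y) = inner ℂ (freeEval U s x) y := by
  rw [map_star, ContinuousLinearMap.star_eq_adjoint, ContinuousLinearMap.adjoint_inner_right]

end FreeEval

/-- The generator `u_k` in `S_m`. -/
noncomputable def freeGen {m : ℕ} (k : Fin m) : freeSystem m :=
  ⟨universalUnitary m k, Submodule.subset_span (by simp)⟩

theorem universalUnitary_star_mul_self {m : ℕ} (k : Fin m) :
    star (universalUnitary m k) * universalUnitary m k = 1 := by
  refine Subtype.ext (Subtype.ext (funext fun π => ?_))
  exact Unitary.coe_star_mul_self (π.rep (FreeGroup.of k))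

/-- Linear functionals on `S_m` are determined by their values at `1`, `u_k` and `u_k^*`. -/
theorem freeSystem_dual_ext {m : ℕ} {f g : OpDual (freeSystem m)}
    (h1 : f ⟨1, (freeSystem m).one_mem'⟩ = g ⟨1, (freeSystem m).one_mem'⟩)
    (hu : ∀ k, f (freeGen k) = g (freeGen k))
    (hs : ∀ k, f (star (freeGen k)) = g (star (freeGen k))) : f = g := by
  ext ⟨x, hx⟩
  change x ∈ Submodule.span ℂ _ at hx
  induction hx using Submodule.span_induction with
  | mem x hx =>
    rcases hx with (hx | ⟨k, rfl⟩) | ⟨k, rfl⟩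
    · obtain rfl : x = 1 := hx
      exact h1
    · exact hu k
    · exact hs k
  | zero => exact (map_zero f).trans (map_zero g).symm
  | add x y hx hy ihx ihy =>
    exact (map_add f (⟨x, hx⟩ : freeSystem m) ⟨y, hy⟩).trans
      ((congrArg₂ (· + ·) ihx ihy).trans (map_add g (⟨x, hx⟩ : freeSystem m) ⟨y, hy⟩).symm)
  | smul c x hx ih =>
    exact (map_smul f c (⟨x, hx⟩ : freeSystem m)).trans
      ((congrArg (c • ·) ih).trans (map_smul g c (⟨x, hx⟩ : freeSystem m)).symm)

/-- The matrix `[1 u_k; u_k^* 1]` over `S_m`. -/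
noncomputable def freeBlock {m : ℕ} (k : Fin m) : Matrix (Fin 2) (Fin 2) (freeSystem m) :=
  !![⟨1, (freeSystem m).one_mem'⟩, freeGen k; star (freeGen k), ⟨1, (freeSystem m).one_mem'⟩]

/-- The block is `Rᴴ R` for the row `R = [1 u_k]`, because `u_k^* u_k = 1`. -/
theorem freeBlock_pos {m : ℕ} (k : Fin m) : freeBlock k ∈ MatrixOrderedSpace.pos 2 := by
  change OperatorSubsystem.incl _ _ ∈ matrixPos _ _
  have : OperatorSubsystem.incl (freeSystem m) (freeBlock k) =
      (!![1, universalUnitary m k] : Matrix (Fin 1) (Fin 2) _)ᴴ * !![1, universalUnitary m k] := by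
    ext i j : 1
    fin_cases i <;> fin_cases j <;>
      simp [OperatorSubsystem.incl, freeBlock, freeGen, Matrix.mul_apply,
        universalUnitary_star_mul_self]
  rw [this]
  exact matrixPos_conj _

theorem freeBlock_diag {m : ℕ} (k : Fin m) (i : Fin 2) :
    freeBlock k i i = ⟨1, (freeSystem m).one_mem'⟩ := by
  fin_cases i <;> simp [freeBlock]

theorem freeBlock_zero_one {m : ℕ} (k : Fin m) : freeBlock k 0 1 = freeGen k := by
  simp [freeBlock]

theorem freeBlock_one_zero {m : ℕ} (k : Fin m) : freeBlock k 1 0 = star (freeGen k) := by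
  simp [freeBlock]

/-- The map `S_m^d → U_{m+1}` that records the values on the blocks `[1 u_k; u_k^* 1]`. -/
noncomputable def freeDualMap (m : ℕ) : OpDual (freeSystem m) →ₗ[ℂ] systemU (m + 1) where
  toFun f := ⟨fun k => CStarMatrix.ofMatrix fun i j => f (freeBlock (m := m) k i j), by
    intro k l i j
    change f (freeBlock (m := m) k i i) = f (freeBlock (m := m) l j j)
    rw [freeBlock_diag, freeBlock_diag]⟩
  map_add' _ _ := rfl
  map_smul' _ _ := rfl

theorem freeDualMap_apply {m : ℕ} (f : OpDual (freeSystem m)) (k : Fin m) (i j : Fin 2) :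
    (freeDualMap m f).1 k i j = f (freeBlock k i j) := rfl

/-- The vector functional `s ↦ ⟪x, π(s) y⟫` of the representation of `F_m` given by unitaries. -/
noncomputable def freeVectorFunctional {m : ℕ} {H : Type} [NormedAddCommGroup H] [InnerProductSpace ℂ H]
    [CompleteSpace H] [Nontrivial H] (U : Fin m → H ≃ₗᵢ[ℂ] H) (x y : H) :
    OpDual (freeSystem m) :=
  ({ toFun := fun s => inner ℂ x (freeEval U s y)
     map_add' := fun s t => by simp
     map_smul' := fun c s => by simp } : freeSystem m →ₗ[ℂ] ℂ)

section VectorFunctional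

variable {m : ℕ} {H : Type} [NormedAddCommGroup H] [InnerProductSpace ℂ H]
  [CompleteSpace H] [Nontrivial H] (U : Fin m → H ≃ₗᵢ[ℂ] H) (x y : H)

theorem freeVectorFunctional_apply (s : freeSystem m) :
    freeVectorFunctional U x y s =
      inner ℂ x (freeEval U (s : FullGroupCStar (FreeGroup (Fin m))) y) := rfl

theorem freeVectorFunctional_one :
    freeVectorFunctional U x y ⟨1, (freeSystem m).one_mem'⟩ = inner ℂ x y := by
  rw [freeVectorFunctional_apply, map_one]
  rfl

theorem freeVectorFunctional_gen (k : Fin m) :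
    freeVectorFunctional U x y (freeGen k) = inner ℂ x (U k y) := by
  rw [freeVectorFunctional_apply]
  exact congrArg _ (freeEval_universalUnitary U k y)

theorem freeVectorFunctional_star_gen (k : Fin m) :
    freeVectorFunctional U x y (star (freeGen k)) = inner ℂ (U k x) y := by
  rw [freeVectorFunctional_apply, OperatorSubsystem.coe_star, inner_freeEval_star]
  exact congrArg (inner ℂ · y) (freeEval_universalUnitary U k x)

end VectorFunctional

/-- The cyclic shift on `ℂ³`. -/
noncomputable def cyclicShift : EuclideanSpace ℂ (Fin 3) ≃ₗᵢ[ℂ] EuclideanSpace ℂ (Fin 3) :=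
  LinearIsometryEquiv.piLpCongrLeft 2 ℂ ℂ (Equiv.addRight (1 : Fin 3))

theorem cyclicShift_single (i : Fin 3) :
    cyclicShift (EuclideanSpace.single i 1) = EuclideanSpace.single (i + 1) 1 :=
  LinearIsometryEquiv.piLpCongrLeft_single _ _ _

theorem freeDualMap_bijective {m : ℕ} (hm : 0 < m) : Function.Bijective (freeDualMap m) := by
  constructor
  · refine (injective_iff_map_eq_zero _).2 fun f hf => ?_
    have hf' : ∀ (k : Fin m) (i j : Fin 2), f (freeBlock k i j) = 0 := fun k i j => by
      rw [← freeDualMap_apply, hf]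
      rfl
    exact freeSystem_dual_ext (hf' ⟨0, hm⟩ 0 0) (fun k => hf' k 0 1) (fun k => hf' k 1 0)
  · rintro ⟨y, hy⟩
    have hU : ∀ (k l : Fin m) (i j : Fin 2), y k i i = y l j j := hy
    let e : Fin 3 → EuclideanSpace ℂ (Fin 3) := fun i => EuclideanSpace.single i 1
    have he : ∀ i j, inner ℂ (e i) (e j) = if i = j then 1 else 0 := fun i j => by
      simp [e, EuclideanSpace.inner_single_left]
    have hn : ∀ i, ‖e i‖ = 1 := fun i => by simp [e]
    have hS : ∀ i, cyclicShift (e i) = e (i + 1) := cyclicShift_single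
    -- `S l` represents `u_l` by the shift and every other generator by the identity, which isolates
    -- the index `l`.
    let S : Fin m → Fin m → EuclideanSpace ℂ (Fin 3) ≃ₗᵢ[ℂ] EuclideanSpace ℂ (Fin 3) :=
      fun l k => if k = l then cyclicShift else LinearIsometryEquiv.refl ℂ _
    have hSS : ∀ l k i, S l k (e i) = if k = l then e (i + 1) else e i := fun l k i => by
      by_cases h : k = l <;> simp [S, h, hS]
    -- The shift sends `e 0` to `e 1` and its inverse sends `e 0` to `e 2`. By orthogonality, the
    -- three kinds of vector functional are dual to `1`, `u_l` and `u_l^*`; dimension three is what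
    -- keeps `u_l` and `u_l^*` apart.
    let f : OpDual (freeSystem m) :=
      y ⟨0, hm⟩ 0 0 • freeVectorFunctional (fun _ => cyclicShift) (e 0) (e 0) +
      ∑ l : Fin m, (y l 0 1 • freeVectorFunctional (S l) (e 1) (e 0) +
        y l 1 0 • freeVectorFunctional (S l) (e 2) (e 0))
    have h1 : f ⟨1, (freeSystem m).one_mem'⟩ = y ⟨0, hm⟩ 0 0 := by
      simp [f, OpDual.sum_apply, freeVectorFunctional_one, he, hn]
    have h2 : ∀ k, f (freeGen k) = y k 0 1 := fun k => by
      simp only [f, OpDual.sum_apply, freeVectorFunctional_gen, OpDual.add_apply,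
        OpDual.smul_apply, hS, hSS, he]
      simp [apply_ite (inner ℂ _), he, hn]
    have h3 : ∀ k, f (star (freeGen k)) = y k 1 0 := fun k => by
      simp only [f, OpDual.sum_apply, freeVectorFunctional_star_gen, OpDual.add_apply,
        OpDual.smul_apply, hS, hSS, he]
      simp [apply_ite fun x => inner ℂ x (e 0), he, hn]
    refine ⟨f, Subtype.ext (funext fun k => ?_)⟩
    ext i j
    change f (freeBlock (m := m) k i j) = _
    fin_cases i <;> fin_cases j
    · exact h1.trans (hU _ _ _ _)
    · exact h2 k
    · exact h3 k
    · exact h1.trans (hU _ _ _ _)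

/-- Writing `π` for `freeEval U` and `X = Bᴴ B`, one has `⟪v_a, π(X_kl) v_b⟫ = ∑ x, ⟪π(B_xk) v_a,
π(B_xl) v_b⟫`, again a sum of Gram matrices. -/
theorem hat_posSemidef_of_vectorFunctional {m p q : ℕ} {H : Type} [NormedAddCommGroup H]
    [InnerProductSpace ℂ H] [CompleteSpace H] [Nontrivial H] (U : Fin m → H ≃ₗᵢ[ℂ] H)
    (v : Fin p → H) {X : Matrix (Fin q) (Fin q) (freeSystem m)}
    (hX : X ∈ MatrixOrderedSpace.pos q) :
    (OpDual.hat (Matrix.of fun a b => freeVectorFunctional U (v a) (v b)) X).PosSemidef := by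
  obtain ⟨B, hB⟩ := hX
  refine posSemidef_of_eq_sum_inner
    (fun (x : Fin q) (y : Fin q × Fin p) => freeEval U (B x y.1) (v y.2)) ?_
  rintro ⟨k, a⟩ ⟨l, b⟩
  have hX' : (X k l : FullGroupCStar (FreeGroup (Fin m))) = ∑ x, star (B x k) * B x l :=
    congrFun (congrFun hB k) l
  change inner ℂ (v a) (freeEval U (X k l : FullGroupCStar (FreeGroup (Fin m))) (v b)) = _
  rw [hX', map_sum, sum_apply, inner_sum]
  refine Finset.sum_congr rfl fun x _ => ?_
  rw [map_mul, mul_apply_eq_comp, inner_freeEval_star]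

theorem freeDual_pos_iff {m p : ℕ} (hm : 0 < m)
    (G : Matrix (Fin p) (Fin p) (OpDual (freeSystem m))) :
    G ∈ MatrixOrderedSpace.pos p ↔ G.map (freeDualMap m) ∈ MatrixOrderedSpace.pos p := by
  change _ ↔ OperatorSubsystem.incl _ (G.map (freeDualMap m)) ∈ matrixPos (SumM2 m) p
  rw [mem_matrixPos_sumM2_iff]
  constructor
  · exact fun hG k => hG 2 (freeBlock k) (freeBlock_pos k)
  · intro h q X hX
    -- For `p = 0` the space of the Gram vectors is zero, whereas a `UnitaryRep` requires a nonzero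
    -- space.
    rcases p with _ | p
    · rw [Subsingleton.elim (OpDual.hat G X) 0]
      exact Matrix.PosSemidef.zero
    choose c hc using fun k => exists_inner_of_posSemidef (h k)
    have hc' : ∀ (k : Fin m) i j a b,
        inner ℂ (c k (i, a)) (c k (j, b)) = G a b (freeBlock k i j) :=
      fun k i j a b => (hc k (i, a) (j, b)).symm
    have hd : ∀ (k : Fin m) i a b, inner ℂ (c k (i, a)) (c k (i, b)) =
        G a b ⟨1, (freeSystem m).one_mem'⟩ := fun k i a b => by
      rw [hc', freeBlock_diag]
    let v : Fin (p + 1) → EuclideanSpace ℂ (Fin 2 × Fin (p + 1)) := fun a => c ⟨0, hm⟩ (0, a)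
    choose Y hY using fun k => exists_linearIsometryEquiv_of_gram_eq v (fun a => c k (0, a))
      fun a b => (hd ⟨0, hm⟩ 0 a b).trans (hd k 0 a b).symm
    choose Z hZ using fun k => exists_linearIsometryEquiv_of_gram_eq v (fun a => c k (1, a))
      fun a b => (hd ⟨0, hm⟩ 0 a b).trans (hd k 1 a b).symm
    -- With `U_k = Y_k⁻¹ Z_k`, applying `Y_k` gives `⟪v_a, U_k v_b⟫ = ⟪Y_k v_a, Z_k v_b⟫`, the
    -- off-diagonal entry of block `k`.
    let U := fun k => (Z k).trans (Y k).symm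
    have hG : G = Matrix.of fun a b => freeVectorFunctional U (v a) (v b) := by
      ext a b : 1
      rw [Matrix.of_apply]
      refine freeSystem_dual_ext ?_ (fun k => ?_) fun k => ?_
      · rw [freeVectorFunctional_one]
        exact (hd ⟨0, hm⟩ 0 a b).symm
      · rw [freeVectorFunctional_gen, ← (Y k).inner_map_map]
        simp only [U, LinearIsometryEquiv.trans_apply, LinearIsometryEquiv.apply_symm_apply,
          hY, hZ]
        rw [hc', freeBlock_zero_one]
      · rw [freeVectorFunctional_star_gen, ← (Y k).inner_map_map]
        simp only [U, LinearIsometryEquiv.trans_apply, LinearIsometryEquiv.apply_symm_apply,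
          hY, hZ]
        rw [hc', freeBlock_one_zero]
    rw [hG]
    exact hat_posSemidef_of_vectorFunctional U v hX

theorem freeDual_completelyOrderIsomorphic {m : ℕ} (hm : 0 < m) :
    CompletelyOrderIsomorphic (OpDual (freeSystem m)) (systemU (m + 1)) :=
  completelyOrderIsomorphic_of_bijective (freeDualMap m) (freeDualMap_bijective hm)
    fun _ G => freeDual_pos_iff hm G

end OpSys

theorem mainTheorem9 (n : ℕ) (hn : 2 ≤ n) :
    OpSys.CompletelyOrderIsomorphic
        (OpSys.OpDual (OpSys.tridiagonalSystem n)) (OpSys.systemV n) ∧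
      OpSys.CompletelyOrderIsomorphic
        (OpSys.OpDual (OpSys.freeSystem (n - 1))) (OpSys.systemU n) := by
  obtain ⟨m, rfl⟩ : ∃ m, n = m + 1 := ⟨n - 1, by omega⟩
  exact ⟨OpSys.tridiagonalDual_completelyOrderIsomorphic (by omega),
    OpSys.freeDual_completelyOrderIsomorphic (by omega)⟩
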